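/- Let $(X,\|\cdot\|)$ be a real normed space with a modulus of uniform convexity $\eta:(0,2]\to(0,1]$, i.e. for all $\varepsilon\in(0,2]$ and $x,y\in X$ with $\|x\|,\|y\|\le 1$ and $\|x-y\|\ge\varepsilon$ one has $\|\tfrac12(x+y)\|\le 1-\eta(\varepsilon)$; extend $\eta$ to $(0,\infty)$ by any values in $(0,1]$ on $(2,\infty)$ (e.g. the value $1$). Let $C\subseteq X$ be convex and let $b>0$ satisfy $\|x\|\le b$ for all $x\in C$. For $z\in X$ let $J(z)=\{j\in X^*: j(z)=\|z\|^2=\|j\|^2\}$ (the normalized duality mapping). Let $T:C\to C$ be nonexpansive and such that $A:=I-T$ (with domain $C$) is uniformly accretive with modulus $\Omega:(0,\infty)^2\to(0,\infty)$, i.e. for all $x,y\in C$ and all $b',\varepsilon>0$ there is $j\in J(x-y)$ such that $$\max\{\|x\|,\|y\|\}\le b'\ \wedge\ \bigl|\|x\|-\|y\|\bigr|\ge\varepsilon\ \Longrightarrow\ j(Ax-Ay)>\Omega(\varepsilon,b').$$ Write $\Omega(\varepsilon):=\Omega(\varepsilon,b)$ and, for $\varepsilon>0$, put $$\omega_b(\varepsilon):=\frac1{16b}\,\Omega\!\left(\frac\varepsilon2\,\eta\!\left(\frac\varepsilon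 b\right)\right)\cdot\eta\!\left(\frac1{8b^2}\,\Omega\!\left(\frac\varepsilon2\,\eta\!\left(\frac\varepsilon b\right)\right)\right).$$ If $\eta(\varepsilon)=\varepsilon\,\tilde\eta(\varepsilon)$ on $(0,2]$ with $\tilde\eta$ nondecreasing, one may instead put $$\omega_b(\varepsilon):=\min\left\{b\,\eta\!\left(\frac{\Omega(b\,\eta(\varepsilon/b))}{8b^2}\right),\ \frac{\Omega(b\,\eta(\varepsilon/b))}{4b}\right\}.$$ Let $(\beta_n)_{n\ge0}\subset[0,1]$ be such that $\sum_{n=0}^\infty\beta_n(1-\beta_n)=\infty$ with rate of divergence $\gamma:\mathbb N\to\mathbb N$, i.e. $\sum_{i=0}^{\gamma(k)}\beta_i(1-\beta_i)\ge k$ for all $k\in\mathbb N$. For $x_0\in C$ define $x_{n+1}:=(1-\beta_n)x_n+\beta_nTx_n$. Then, for either choice of $\omega_b$, $(x_n)$ is a Cauchy sequence, with $$\forall\varepsilon>0\ \forall n,m\ge\gamma\!\left(\left\lceil\frac{4b^2}{\pi\,\omega_b(\varepsilon)^2}\right\rceil\right):\quad \|x_n-x_m\|\le\varepsilon .$$ If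 moreover $X$ is complete and $C$ is closed, then $T$ has a unique fixed point $p\in C$, $(x_n)$ converges to $p$, and $\|x_n-p\|\le\varepsilon$ for all $\varepsilon>0$ and all $n\ge\gamma\bigl(\bigl\lceil 4b^2/(\pi\,\omega_b(\varepsilon)^2)\bigr\rceil\bigr)$. -/

import Mathlib

open Set Filter Topology

/-- The normalized duality mapping `J : X → 2^(X*)` of a real normed space,
`J x = {j | ⟨x, j⟩ = ‖x‖² = ‖j‖²}`. -/
def normalizedDuality {X : Type*} [NormedAddCommGroup X] [NormedSpace ℝ X] (x : X) :
    Set (StrongDual ℝ X) :=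
  {j | j x = ‖x‖ ^ 2 ∧ ‖j‖ ^ 2 = ‖x‖ ^ 2}

/-- The graph of the single-valued operator `A = I - T` with domain `D(A) = C`. -/
def idSubGraph {X : Type*} [NormedAddCommGroup X] (T : X → X) (C : Set X) : Set (X × X) :=
  {p | p.1 ∈ C ∧ p.2 = p.1 - T p.1}

/-- `Ω : (0,∞)² → (0,∞)` is a modulus of uniform accretivity for the (possibly set-valued)
operator whose graph is `A`. -/
def IsUniformAccretivityModulus {X : Type*} [NormedAddCommGroup X] [NormedSpace ℝ X]
    (A : Set (X × X)) (Ω : ℝ → ℝ → ℝ) : Prop :=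
  (∀ ε > 0, ∀ b > 0, 0 < Ω ε b) ∧
  ∀ x u y v : X, (x, u) ∈ A → (y, v) ∈ A → ∀ b > 0, ∀ ε > 0,
    ∃ j ∈ normalizedDuality (x - y),
      max ‖x‖ ‖y‖ ≤ b ∧ ε ≤ |‖x‖ - ‖y‖| → Ω ε b < j (u - v)

/-- `η : (0,2] → (0,1]` is a modulus of uniform convexity of `X`. Beyond `2`, where the defining
implication would be vacuous, `η` is extended by arbitrary values in `(0,1]`. -/
def IsUniformConvexityModulus (X : Type*) [NormedAddCommGroup X] [NormedSpace ℝ X]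
    (η : ℝ → ℝ) : Prop :=
  (∀ ε > 0, η ε ∈ Ioc (0 : ℝ) 1) ∧
  ∀ ε ∈ Ioc (0 : ℝ) 2, ∀ x y : X, ‖x‖ ≤ 1 → ‖y‖ ≤ 1 → ε ≤ ‖x - y‖ →
    ‖(1 / 2 : ℝ) • (x + y)‖ ≤ 1 - η ε

/-- `η ε = ε * η' ε` on `(0,2]` with `η'` nondecreasing. -/
def HasMonotoneFactor (η : ℝ → ℝ) : Prop :=
  ∃ η' : ℝ → ℝ, (∀ ε ∈ Ioc (0 : ℝ) 2, η ε = ε * η' ε) ∧ MonotoneOn η' (Ioc (0 : ℝ) 2)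

/-- The modulus of uniqueness `ω_b`. -/
noncomputable def uniquenessModulus (η : ℝ → ℝ) (Ω : ℝ → ℝ → ℝ) (b ε : ℝ) : ℝ :=
  1 / (16 * b) * Ω (ε / 2 * η (ε / b)) b
    * η (1 / (8 * b ^ 2) * Ω (ε / 2 * η (ε / b)) b)

/-- The improved modulus of uniqueness `ω_b`, for `η` with a monotone factor. -/
noncomputable def improvedUniquenessModulus (η : ℝ → ℝ) (Ω : ℝ → ℝ → ℝ) (b ε : ℝ) : ℝ :=
  min (b * η (Ω (b * η (ε / b)) b / (8 * b ^ 2))) (Ω (b * η (ε / b)) b / (4 * b))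

/-- `γ` is a rate of divergence for `∑ a i = ∞`. -/
def IsDivergenceRate (γ : ℕ → ℕ) (a : ℕ → ℝ) : Prop :=
  ∀ k : ℕ, (k : ℝ) ≤ ∑ i ∈ Finset.range (γ k + 1), a i

/-- `ρ : (0,∞) → ℕ` is a Cauchy rate of the sequence `x`. -/
def IsCauchyRate {X : Type*} [NormedAddCommGroup X] (ρ : ℝ → ℕ) (x : ℕ → X) : Prop :=
  ∀ ε > 0, ∀ n ≥ ρ ε, ∀ m ≥ ρ ε, ‖x n - x m‖ ≤ ε

/-- `ρ : (0,∞) → ℕ` is a rate of convergence of the sequence `x` towards `p`. -/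
def IsConvergenceRate {X : Type*} [NormedAddCommGroup X] (ρ : ℝ → ℕ) (x : ℕ → X) (p : X) :
    Prop :=
  ∀ ε > 0, ∀ n ≥ ρ ε, ‖x n - p‖ ≤ ε

/-- The Krasnoselskii-Mann iteration `x (n+1) = (1 - β n) x n + β n T (x n)`, `x 0 = x₀`. -/
def krasnoselskiiMann {X : Type*} [NormedAddCommGroup X] [NormedSpace ℝ X]
    (T : X → X) (β : ℕ → ℝ) (x₀ : X) : ℕ → X
  | 0 => x₀
  | n + 1 => (1 - β n) • krasnoselskiiMann T β x₀ n + β n • T (krasnoselskiiMann T β x₀ n)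

/-- The rate `ε ↦ γ ⌈4b² / (π ω(ε)²)⌉`. -/
noncomputable def kmRate (γ : ℕ → ℕ) (b : ℝ) (ω : ℝ → ℝ) (ε : ℝ) : ℕ :=
  γ ⌈4 * b ^ 2 / (Real.pi * (ω ε) ^ 2)⌉₊

/-! Two independent estimates meet. The first is a modulus of uniqueness: points of `C` with
residual at most `2 * ω ε` lie within `ε` of each other (`norm_sub_le_of_approx_fixed`). If `x` and
`y` were further apart, uniform convexity would push the norm of their midpoint `z` well below the
larger of `‖x‖`, `‖y‖`, and accretivity would then force a large residual at `z`. But `T z` is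
almost as close to `x` and `y` as `z` is, so uniform convexity also forces `T z` near `z`: a
contradiction.

The second is asymptotic regularity with a rate. The distances between iterates and their images
obey the recursion of a random walk on `ℤ` with step probabilities `β i`
(`krasnoselskiiMann_dist_le`). On the diagonal the walk is symmetric, and a Fourier integral bounds
the residual at time `n` by a multiple of `1 / √(∑ β i (1 - β i))`.

Two late iterates, or a late iterate and a fixed point, are thus approximate fixed points, hence
close. -/

/-- The survival function of the walk dominating a Krasnoselskii-Mann iteration: start from the
sign function on `ℤ`, and apply the up-steps `β 0, …, β (n-1)` and the down-steps
`β 0, …, β (m-1)`. -/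
noncomputable def walkBound (β : ℕ → ℝ) : ℕ → ℕ → ℤ → ℝ
  | 0, 0, k => (k.sign : ℝ)
  | 0, m + 1, k => (1 - β m) * walkBound β 0 m k + β m * walkBound β 0 m (k - 1)
  | n + 1, m, k => (1 - β n) * walkBound β n m k + β n * walkBound β n m (k + 1)

/-! ### Symmetries and recursions of the dominating walk. -/

theorem walkBound_succ_left (β : ℕ → ℝ) (n m : ℕ) (k : ℤ) :
    walkBound β (n + 1) m k = (1 - β n) * walkBound β n m k + β n * walkBound β n m (k + 1) := by
  rw [walkBound]

/-- Up-steps and down-steps commute, so a down-step can be peeled off for every `n`, not only for `n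
= 0`. -/
theorem walkBound_succ_right (β : ℕ → ℝ) (n m : ℕ) (k : ℤ) :
    walkBound β n (m + 1) k = (1 - β m) * walkBound β n m k + β m * walkBound β n m (k - 1) := by
  induction n generalizing k with
  | zero => rw [walkBound]
  | succ n ih =>
    simp only [walkBound_succ_left, ih]
    rw [show k + 1 - 1 = k by ring, show k - 1 + 1 = k by ring]
    ring

theorem walkBound_neg (β : ℕ → ℝ) (n m : ℕ) (k : ℤ) :
    walkBound β n m (-k) = -walkBound β m n k := by
  induction n generalizing m k with
  | zero =>
    induction m generalizing k with
    | zero => simp [walkBound]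
    | succ m ih =>
      rw [walkBound_succ_right, walkBound_succ_left, ih, show -k - 1 = -(k + 1) by ring, ih]
      ring
  | succ n ih =>
    rw [walkBound_succ_right, walkBound_succ_left, ih, show -k + 1 = -(k - 1) by ring, ih]
    ring

theorem walkBound_self_zero (β : ℕ → ℝ) (n : ℕ) : walkBound β n n 0 = 0 := by
  have := walkBound_neg β n n 0
  simp only [neg_zero] at this
  linarith

theorem walkBound_zero_right (β : ℕ → ℝ) (n : ℕ) {k : ℤ} (hk : 0 < k) :
    walkBound β n 0 k = 1 := by
  induction n generalizing k with
  | zero => simp [walkBound, Int.sign_eq_one_of_pos hk]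
  | succ n ih =>
    rw [walkBound_succ_left, ih hk, ih (by omega)]
    ring

/-- One up-step and one down-step combine to a lazy symmetric step: `±1` with probability `β n * (1
- β n)` each. -/
theorem walkBound_succ_self (β : ℕ → ℝ) (n : ℕ) (k : ℤ) :
    walkBound β (n + 1) (n + 1) k = (1 - 2 * (β n * (1 - β n))) * walkBound β n n k
      + β n * (1 - β n) * (walkBound β n n (k + 1) + walkBound β n n (k - 1)) := by
  rw [walkBound_succ_left, walkBound_succ_right, walkBound_succ_right,
    show k + 1 - 1 = k by ring]
  ring

/-! ### Domination of the iteration by the walk. -/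

section Iteration

variable {X : Type*} [NormedAddCommGroup X] [NormedSpace ℝ X]

theorem krasnoselskiiMann_mem {C : Set X} (hC : Convex ℝ C) {T : X → X} (hTC : MapsTo T C C)
    {β : ℕ → ℝ} (hβ : ∀ n, β n ∈ Icc (0 : ℝ) 1) {x₀ : X} (hx₀ : x₀ ∈ C) (n : ℕ) :
    krasnoselskiiMann T β x₀ n ∈ C := by
  induction n with
  | zero => exact hx₀
  | succ n ih =>
    exact hC ih (hTC ih) (sub_nonneg.2 (hβ n).2) (hβ n).1 (by ring)

theorem norm_krasnoselskiiMann_succ_sub_le (T : X → X) {β : ℕ → ℝ}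
    (hβ : ∀ n, β n ∈ Icc (0 : ℝ) 1) (x₀ : X) (n : ℕ) (y : X) :
    ‖krasnoselskiiMann T β x₀ (n + 1) - y‖ ≤
      (1 - β n) * ‖krasnoselskiiMann T β x₀ n - y‖
        + β n * ‖T (krasnoselskiiMann T β x₀ n) - y‖ := by
  have h : krasnoselskiiMann T β x₀ (n + 1) - y =
      (1 - β n) • (krasnoselskiiMann T β x₀ n - y)
        + β n • (T (krasnoselskiiMann T β x₀ n) - y) := by
    rw [krasnoselskiiMann]
    module
  rw [h]
  refine (norm_add_le _ _).trans ?_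
  rw [norm_smul, norm_smul, Real.norm_of_nonneg (hβ n).1,
    Real.norm_of_nonneg (sub_nonneg.2 (hβ n).2)]

/-- Convexity of the norm reproduces the walk recursions. Nonexpansiveness bounds `T x_n - T x_m` by
`x_n - x_m`, which sends level `1` to level `0` on a down-step. -/
theorem krasnoselskiiMann_dist_le {C : Set X} (hC : Convex ℝ C) {D : ℝ}
    (hD : ∀ x ∈ C, ∀ y ∈ C, ‖x - y‖ ≤ D)
    {T : X → X} (hTC : MapsTo T C C) (hT : ∀ x ∈ C, ∀ y ∈ C, ‖T x - T y‖ ≤ ‖x - y‖)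
    {β : ℕ → ℝ} (hβ : ∀ n, β n ∈ Icc (0 : ℝ) 1) {x₀ : X} (hx₀ : x₀ ∈ C) (m : ℕ) :
    ∀ n ≥ m,
      ‖krasnoselskiiMann T β x₀ n - krasnoselskiiMann T β x₀ m‖ ≤ D * walkBound β n m 0 ∧
      ‖T (krasnoselskiiMann T β x₀ n) - krasnoselskiiMann T β x₀ m‖ ≤ D * walkBound β n m 1 := by
  have hmem := krasnoselskiiMann_mem hC hTC hβ hx₀
  have key : ∀ m, (∀ n ≥ m, ‖T (krasnoselskiiMann T β x₀ n) - krasnoselskiiMann T β x₀ m‖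
      ≤ D * walkBound β n m 1) → ∀ n ≥ m,
      ‖krasnoselskiiMann T β x₀ n - krasnoselskiiMann T β x₀ m‖ ≤ D * walkBound β n m 0 := by
    intro m hm n hn
    induction n, hn using Nat.le_induction with
    | base => simp [walkBound_self_zero]
    | succ n hn ih =>
      refine (norm_krasnoselskiiMann_succ_sub_le T hβ x₀ n _).trans ?_
      rw [walkBound_succ_left, zero_add]
      have h1 := mul_le_mul_of_nonneg_left ih (sub_nonneg.2 (hβ n).2)
      have h2 := mul_le_mul_of_nonneg_left (hm n hn) (hβ n).1
      linarith
  suffices H : ∀ n ≥ m, ‖T (krasnoselskiiMann T β x₀ n) - krasnoselskiiMann T β x₀ m‖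
      ≤ D * walkBound β n m 1 from fun n hn => ⟨key m H n hn, H n hn⟩
  induction m with
  | zero =>
    intro n _
    rw [walkBound_zero_right β n one_pos, mul_one]
    exact hD _ (hTC (hmem n)) _ hx₀
  | succ m ih =>
    intro n hn
    rw [norm_sub_rev]
    refine (norm_krasnoselskiiMann_succ_sub_le T hβ x₀ m _).trans ?_
    rw [walkBound_succ_right, sub_self]
    have hnm : n ≥ m := by omega
    have h1 := mul_le_mul_of_nonneg_left (ih n hnm) (sub_nonneg.2 (hβ m).2)
    have h2 := mul_le_mul_of_nonneg_left
      ((hT _ (hmem n) _ (hmem m)).trans (key m ih n hnm)) (hβ m).1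
    rw [norm_sub_rev, norm_sub_rev (T _) (T _)]
    linarith

end Iteration

/-! ### Fourier representation and Gaussian bound. -/

/-- The increment of the sign function is the indicator of `{-1, 0}`, and each lazy symmetric step
acts on `cos (k t)` as the multiplier `1 - 2 p (1 - cos t)`, with `p = β i * (1 - β i)`. -/
theorem walkBound_add_one_sub (β : ℕ → ℝ) (n : ℕ) (k : ℤ) :
    walkBound β n n (k + 1) - walkBound β n n k = 1 / (2 * Real.pi) *
      ∫ t in -Real.pi..Real.pi, (Real.cos (k * t) + Real.cos ((k + 1) * t)) *
        ∏ i ∈ Finset.range n, (1 - 2 * (β i * (1 - β i)) * (1 - Real.cos t)) := by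
  have hπ := Real.pi_pos
  induction n generalizing k with
  | zero =>
    have hcos : ∀ k : ℤ, ∫ t in -Real.pi..Real.pi, Real.cos (k * t) =
        if k = 0 then 2 * Real.pi else 0 := by
      intro k
      split_ifs with hk
      · simp [hk]; ring
      · have hk' : (k : ℝ) ≠ 0 := by exact_mod_cast hk
        rw [intervalIntegral.integral_comp_mul_left (fun t => Real.cos t) hk', integral_cos]
        simp [Real.sin_int_mul_pi]
    have hint : ∀ k : ℤ, IntervalIntegrable (fun t => Real.cos (k * t)) MeasureTheory.volume
        (-Real.pi) Real.pi := fun k => (by fun_prop : Continuous _).intervalIntegrable _ _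
    have := hint (k + 1)
    have hc := hcos (k + 1)
    push_cast at this hc
    simp only [Finset.range_zero, Finset.prod_empty, mul_one, walkBound]
    rw [intervalIntegral.integral_add (hint k) this, hc, hcos]
    rcases lt_trichotomy k (-1) with h | h | h
    · rw [Int.sign_eq_neg_one_of_neg (by omega), Int.sign_eq_neg_one_of_neg (by omega),
        if_neg (by omega), if_neg (by omega)]
      simp
    · subst h; simp; field_simp
    · rcases (by omega : k = 0 ∨ 0 < k) with h | h
      · subst h; simp; field_simp
      · rw [Int.sign_eq_one_of_pos (by omega), Int.sign_eq_one_of_pos (by omega),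
          if_neg (by omega), if_neg (by omega)]
        simp
  | succ n ih =>
    have e : walkBound β (n + 1) (n + 1) (k + 1) - walkBound β (n + 1) (n + 1) k =
        (1 - 2 * (β n * (1 - β n))) * (walkBound β n n (k + 1) - walkBound β n n k)
        + β n * (1 - β n) * ((walkBound β n n (k + 1 + 1) - walkBound β n n (k + 1))
          + (walkBound β n n (k - 1 + 1) - walkBound β n n (k - 1))) := by
      rw [walkBound_succ_self, walkBound_succ_self, show k + 1 - 1 = k by ring,
        show k - 1 + 1 = k by ring]
      ring
    have hint : ∀ k : ℤ, IntervalIntegrable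
        (fun t => (Real.cos (k * t) + Real.cos ((k + 1) * t)) *
          ∏ i ∈ Finset.range n, (1 - 2 * (β i * (1 - β i)) * (1 - Real.cos t)))
        MeasureTheory.volume (-Real.pi) Real.pi :=
      fun k => (by fun_prop : Continuous _).intervalIntegrable _ _
    rw [e, ih, ih, ih, ← mul_add, ← intervalIntegral.integral_add (hint _) (hint _),
      mul_left_comm, mul_left_comm (β n * (1 - β n)), ← mul_add,
      ← intervalIntegral.integral_const_mul, ← intervalIntegral.integral_const_mul,
      ← intervalIntegral.integral_add ((hint _).const_mul _)
        (((hint _).add (hint _)).const_mul _)]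
    congr 1
    refine intervalIntegral.integral_congr fun t _ => ?_
    simp only [Finset.prod_range_succ]
    push_cast
    have h1 : Real.cos ((k + 1 + 1 : ℝ) * t) = 2 * Real.cos t * Real.cos ((k + 1 : ℝ) * t)
        - Real.cos (k * t) := by
      rw [show (k + 1 + 1 : ℝ) * t = (k + 1) * t + t by ring,
        show (k : ℝ) * t = (k + 1) * t - t by ring, Real.cos_add, Real.cos_sub]
      ring
    have h2 : Real.cos ((k - 1 : ℝ) * t) = 2 * Real.cos t * Real.cos (k * t)
        - Real.cos ((k + 1 : ℝ) * t) := by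
      rw [show (k + 1 : ℝ) * t = k * t + t by ring,
        show (k - 1 : ℝ) * t = k * t - t by ring, Real.cos_add, Real.cos_sub]
      ring
    rw [h1, h2, show (k - 1 + 1 : ℝ) = k by ring]
    ring

/-- The product of multipliers is at most `exp (-2σ (1 - cos t))`, and `1 - cos t ≥ 2 t² / π²` on
`[-π, π]`; integrating the resulting Gaussian over all of `ℝ` gives the constant. -/
theorem walkBound_self_one_le {β : ℕ → ℝ} (hβ : ∀ n, β n ∈ Icc (0 : ℝ) 1) (n : ℕ)
    (hσ : 0 < ∑ i ∈ Finset.range n, β i * (1 - β i)) :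
    walkBound β n n 1 ≤
      √Real.pi / (2 * √(∑ i ∈ Finset.range n, β i * (1 - β i))) := by
  set σ := ∑ i ∈ Finset.range n, β i * (1 - β i) with hσdef
  have hπ := Real.pi_pos
  have h := walkBound_add_one_sub β n 0
  rw [walkBound_self_zero, zero_add, sub_zero] at h
  have hp : ∀ i, 0 ≤ β i * (1 - β i) ∧ β i * (1 - β i) ≤ 1 / 4 := fun i =>
    ⟨mul_nonneg (hβ i).1 (sub_nonneg.2 (hβ i).2), by nlinarith [sq_nonneg (β i - 1 / 2)]⟩
  have hc : 0 < 4 * σ / Real.pi ^ 2 := by positivity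
  have hbound : ∀ t ∈ Icc (-Real.pi) Real.pi,
      (Real.cos ((0 : ℤ) * t) + Real.cos (((0 : ℤ) + 1) * t)) *
        ∏ i ∈ Finset.range n, (1 - 2 * (β i * (1 - β i)) * (1 - Real.cos t))
      ≤ 2 * Real.exp (-(4 * σ / Real.pi ^ 2) * t ^ 2) := by
    intro t ht
    have hprod : ∏ i ∈ Finset.range n, (1 - 2 * (β i * (1 - β i)) * (1 - Real.cos t)) ≤
        Real.exp (-(4 * σ / Real.pi ^ 2) * t ^ 2) := by
      calc _ ≤ ∏ i ∈ Finset.range n, Real.exp (-(2 * (β i * (1 - β i)) * (1 - Real.cos t))) := by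
            refine Finset.prod_le_prod (fun i _ => ?_) fun i _ => Real.one_sub_le_exp_neg _
            nlinarith [hp i, Real.neg_one_le_cos t, Real.cos_le_one t]
        _ = Real.exp (-(2 * σ) * (1 - Real.cos t)) := by
            rw [← Real.exp_sum, hσdef, Finset.mul_sum, ← Finset.sum_neg_distrib, Finset.sum_mul]
            simp only [neg_mul]
        _ ≤ _ := by
            refine Real.exp_le_exp.2 ?_
            have := Real.cos_le_one_sub_mul_cos_sq (abs_le.2 ht)
            have h2 : 2 * σ * (2 / Real.pi ^ 2 * t ^ 2) ≤ 2 * σ * (1 - Real.cos t) :=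
              mul_le_mul_of_nonneg_left (by linarith) (by positivity)
            calc _ = -(2 * σ * (1 - Real.cos t)) := by ring
              _ ≤ -(2 * σ * (2 / Real.pi ^ 2 * t ^ 2)) := neg_le_neg h2
              _ = _ := by ring
    refine mul_le_mul ?_ hprod (Finset.prod_nonneg fun i _ => ?_) (by norm_num)
    · linarith [Real.cos_le_one ((0 : ℤ) * t), Real.cos_le_one (((0 : ℤ) + 1) * t)]
    · nlinarith [hp i, Real.neg_one_le_cos t, Real.cos_le_one t]
  have hmono : ∫ t in -Real.pi..Real.pi,
      (Real.cos ((0 : ℤ) * t) + Real.cos (((0 : ℤ) + 1) * t)) *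
        ∏ i ∈ Finset.range n, (1 - 2 * (β i * (1 - β i)) * (1 - Real.cos t)) ≤
      2 * √(Real.pi / (4 * σ / Real.pi ^ 2)) := by
    calc _ ≤ ∫ t in -Real.pi..Real.pi, 2 * Real.exp (-(4 * σ / Real.pi ^ 2) * t ^ 2) :=
          intervalIntegral.integral_mono_on (by linarith)
            ((by fun_prop : Continuous _).intervalIntegrable _ _)
            ((by fun_prop : Continuous _).intervalIntegrable _ _) hbound
      _ ≤ ∫ t, 2 * Real.exp (-(4 * σ / Real.pi ^ 2) * t ^ 2) := by
          rw [intervalIntegral.integral_of_le (by linarith)]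
          refine MeasureTheory.setIntegral_le_integral
            ((integrable_exp_neg_mul_sq hc).const_mul 2) (MeasureTheory.ae_of_all _ fun t => ?_)
          positivity
      _ = _ := by rw [MeasureTheory.integral_const_mul, integral_gaussian]
  rw [h]
  calc _ ≤ 1 / (2 * Real.pi) * (2 * √(Real.pi / (4 * σ / Real.pi ^ 2))) :=
        mul_le_mul_of_nonneg_left hmono (by positivity)
    _ = _ := by
        rw [show Real.pi / (4 * σ / Real.pi ^ 2) = Real.pi * (Real.pi / 2) ^ 2 / σ by
            field_simp; ring, Real.sqrt_div (by positivity), Real.sqrt_mul hπ.le,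
          Real.sqrt_sq (by positivity)]
        field_simp

/-! ### Modulus of uniqueness for approximate fixed points. -/

section UniformlyConvex

variable {X : Type*} [NormedAddCommGroup X] [NormedSpace ℝ X]

theorem IsUniformConvexityModulus.norm_midpoint_le {η : ℝ → ℝ}
    (hη : IsUniformConvexityModulus X η) {t R : ℝ} (ht : t ∈ Ioc (0 : ℝ) 2) (hR : 0 < R)
    {x y : X} (hx : ‖x‖ ≤ R) (hy : ‖y‖ ≤ R) (hxy : t * R ≤ ‖x - y‖) :
    ‖(1 / 2 : ℝ) • (x + y)‖ ≤ R * (1 - η t) := by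
  have hR' : (0 : ℝ) ≤ R⁻¹ := (inv_pos.2 hR).le
  have key : ∀ z : X, ‖R⁻¹ • z‖ = ‖z‖ / R := fun z => by
    rw [norm_smul, Real.norm_of_nonneg hR', inv_mul_eq_div]
  have h := hη.2 t ht (R⁻¹ • x) (R⁻¹ • y) (by rw [key]; exact (div_le_one hR).2 hx)
    (by rw [key]; exact (div_le_one hR).2 hy) (by rw [← smul_sub, key]; exact (le_div_iff₀ hR).2 hxy)
  rw [← smul_add, smul_comm, key, div_le_iff₀ hR] at h
  linarith

/-- Displacement of the midpoint of two approximate fixed points of a nonexpansive map. -/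
theorem IsUniformConvexityModulus.midpoint_displacement {η : ℝ → ℝ}
    (hη : IsUniformConvexityModulus X η) {x y w : X} {r t : ℝ} (hr : 0 ≤ r) (hxy : x ≠ y)
    (hx : ‖w - x‖ ≤ ‖x - y‖ / 2 + r) (hy : ‖w - y‖ ≤ ‖x - y‖ / 2 + r) (ht : t ∈ Ioc (0 : ℝ) 2)
    (hw : t * (‖x - y‖ / 2 + r) ≤ ‖(1 / 2 : ℝ) • (x + y) - w‖) :
    (‖x - y‖ / 2 + r) * η t ≤ r := by
  set z := (1 / 2 : ℝ) • (x + y) with hz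
  have hd : 0 < ‖x - y‖ := norm_pos_iff.2 (sub_ne_zero.2 hxy)
  have hzx : ‖z - x‖ = ‖x - y‖ / 2 := by
    rw [show z - x = (-(1 / 2) : ℝ) • (x - y) by rw [hz]; module, norm_smul]
    norm_num; ring
  have hzy : ‖z - y‖ = ‖x - y‖ / 2 := by
    rw [show z - y = ((1 / 2) : ℝ) • (x - y) by rw [hz]; module, norm_smul]
    norm_num; ring
  -- The midpoint of `z` and `w` is within `R (1 - η t)` of both `x` and `y`, where `R = ‖x - y‖ / 2
  -- + r`; the triangle inequality then limits `η t`.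
  have h1 := hη.norm_midpoint_le ht (by linarith : 0 < ‖x - y‖ / 2 + r) (x := z - x) (y := w - x)
    (by linarith) hx (by rwa [sub_sub_sub_cancel_right])
  have h2 := hη.norm_midpoint_le ht (by linarith : 0 < ‖x - y‖ / 2 + r) (x := z - y) (y := w - y)
    (by linarith) hy (by rwa [sub_sub_sub_cancel_right])
  have h3 : ‖x - y‖ ≤ ‖(1 / 2 : ℝ) • (z - y + (w - y))‖ + ‖(1 / 2 : ℝ) • (z - x + (w - x))‖ := by
    refine le_trans (le_of_eq ?_) (norm_sub_le _ _)
    congr 1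
    module
  linarith

theorem norm_sub_le_of_approx_fixed_of_norm_le {C : Set X} (hC : Convex ℝ C) {b : ℝ} (hb : 0 < b)
    (hCb : ∀ x ∈ C, ‖x‖ ≤ b) {η : ℝ → ℝ} (hη : IsUniformConvexityModulus X η)
    {T : X → X} (hTC : MapsTo T C C) (hT : ∀ x ∈ C, ∀ y ∈ C, ‖T x - T y‖ ≤ ‖x - y‖)
    {Ω : ℝ → ℝ → ℝ} (hΩ : IsUniformAccretivityModulus (idSubGraph T C) Ω)
    {ω : ℝ → ℝ} (hω : ω = uniquenessModulus η Ω b ∨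
      (HasMonotoneFactor η ∧ ω = improvedUniquenessModulus η Ω b))
    {ε : ℝ} (hε : 0 < ε) {x y : X} (hx : x ∈ C) (hy : y ∈ C)
    (hyx : ‖y‖ ≤ ‖x‖) (hrx : ‖x - T x‖ ≤ 2 * ω ε) (hry : ‖y - T y‖ ≤ 2 * ω ε) :
    ‖x - y‖ ≤ ε := by
  by_contra! hlt
  set a := ‖x‖ with ha
  have hab : a ≤ b := hCb x hx
  have hda : ‖x - y‖ ≤ 2 * a := (norm_sub_le x y).trans (by linarith)
  have ha0 : 0 < a := by linarith
  have hne : x ≠ y := by rintro rfl; simp at hlt; linarith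
  set z := (1 / 2 : ℝ) • (x + y) with hz
  have hzC : z ∈ C := by
    have := hC hx hy (by norm_num : (0 : ℝ) ≤ 1 / 2) (by norm_num : (0 : ℝ) ≤ 1 / 2) (by norm_num)
    rwa [hz, smul_add]
  have hεb : ε / b ∈ Ioc (0 : ℝ) 2 := ⟨by positivity, by rw [div_le_iff₀ hb]; linarith⟩
  have hεa : ε / a ∈ Ioc (0 : ℝ) 2 := ⟨by positivity, by rw [div_le_iff₀ ha0]; linarith⟩
  have hba : ε / b ≤ ε / a := div_le_div_of_nonneg_left hε.le ha0 hab
  have hxz : ‖x - z‖ = ‖x - y‖ / 2 := by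
    rw [show x - z = ((1 / 2) : ℝ) • (x - y) by rw [hz]; module, norm_smul]
    norm_num; ring
  set r := 2 * ω ε with hr
  have hr0 : 0 ≤ r := (norm_nonneg _).trans hrx
  set s := ‖z - T z‖ with hs
  have hs2 : s ≤ 2 * b := (norm_sub_le _ _).trans (by linarith [hCb z hzC, hCb _ (hTC hzC)])
  -- the norm gap between `x` and the midpoint makes accretivity applicable
  have gap : ∀ δ > 0, δ ≤ a - ‖z‖ → Ω δ b < b * (r + s) := by
    intro δ hδ hgap
    obtain ⟨j, ⟨-, hj⟩, hacc⟩ := hΩ.2 x (x - T x) z (z - T z) ⟨hx, rfl⟩ ⟨hzC, rfl⟩ b hb δ hδ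
    have h := hacc ⟨max_le hab (hCb z hzC), hgap.trans (le_abs_self _)⟩
    have hjn : ‖j‖ = ‖x - z‖ := (sq_eq_sq₀ (norm_nonneg _) (norm_nonneg _)).1 hj
    refine h.trans_le ((le_abs_self _).trans ((j.le_opNorm _).trans ?_))
    rw [hjn, hxz]
    refine mul_le_mul (by linarith) ((norm_sub_le _ _).trans (by linarith)) (norm_nonneg _) hb.le
  have hwx : ‖T z - x‖ ≤ ‖x - y‖ / 2 + r := by
    have h1 := hT z hzC x hx
    rw [norm_sub_rev z x, hxz] at h1
    rw [norm_sub_rev] at hrx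
    calc _ = ‖(T z - T x) + (T x - x)‖ := by congr 1; abel
      _ ≤ _ := (norm_add_le _ _).trans (by linarith)
  have hwy : ‖T z - y‖ ≤ ‖x - y‖ / 2 + r := by
    have h1 := hT z hzC y hy
    have hzy : ‖z - y‖ = ‖x - y‖ / 2 := by
      rw [show z - y = ((1 / 2) : ℝ) • (x - y) by rw [hz]; module, norm_smul]
      norm_num; ring
    rw [hzy] at h1
    rw [norm_sub_rev] at hry
    calc _ = ‖(T z - T y) + (T y - y)‖ := by congr 1; abel
      _ ≤ _ := (norm_add_le _ _).trans (by linarith)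
  set R := ‖x - y‖ / 2 + r with hR
  have hR0 : 0 < R := by linarith
  have hRb : R ≤ b + r := by linarith
  have hsR : s ≤ 2 * R := by
    calc s = ‖(x - T z) - (x - z)‖ := by rw [hs]; congr 1; abel
      _ ≤ ‖x - T z‖ + ‖x - z‖ := norm_sub_le _ _
      _ ≤ 2 * R := by rw [hxz, norm_sub_rev]; linarith
  have disp : ∀ t ∈ Ioc (0 : ℝ) 2, t * R ≤ s → R * η t ≤ r := fun t ht h =>
    hη.midpoint_displacement hr0 hne hwx hwy ht h
  -- Here `r ≤ W / (2b) < s ≤ 2b`, so `R ≤ 3b`; the factor `8 b²` makes `t = W / (8 b²)` satisfy `t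
  -- R ≤ s`.
  have main : ∀ W, 0 < W → W < b * (r + s) → r ≤ W / (2 * b) →
      W / (2 * b) < s ∧ W / (8 * b ^ 2) ∈ Ioc (0 : ℝ) 2 ∧ W / (8 * b ^ 2) * R ≤ s := by
    intro W hW h1 h2
    have h3 : b * r ≤ W / 2 := by
      rw [le_div_iff₀ (by positivity)] at h2; linarith
    have h4 : W / (2 * b) < s := by rw [div_lt_iff₀ (by positivity)]; linarith
    have hR3 : R ≤ 3 * b := by linarith
    refine ⟨h4, ⟨by positivity, ?_⟩, ?_⟩
    · rw [div_le_iff₀ (by positivity)]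
      nlinarith [mul_le_mul_of_nonneg_left hs2 hb.le]
    · calc W / (8 * b ^ 2) * R ≤ W / (8 * b ^ 2) * (3 * b) :=
            mul_le_mul_of_nonneg_left hR3 (by positivity)
        _ = 3 / 4 * (W / (2 * b)) := by field_simp; ring
        _ ≤ s := by
          have : 0 < W / (2 * b) := by positivity
          linarith
  rcases hω with hω | ⟨⟨η', hfac, hmon⟩, hω⟩
  · set δ := ε / 2 * η (ε / b) with hδ
    have hη0 := (hη.1 _ hεb.1).1
    have hδ0 : 0 < δ := by positivity
    have hgap : δ ≤ a - ‖z‖ := by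
      have h := hη.norm_midpoint_le hεb ha0 le_rfl hyx (by
        rw [div_mul_eq_mul_div, div_le_iff₀ hb]
        nlinarith)
      have : ε / 2 * η (ε / b) ≤ a * η (ε / b) := mul_le_mul_of_nonneg_right (by linarith) hη0.le
      linarith
    have hW := hΩ.1 δ hδ0 b hb
    have h1 := gap δ hδ0 hgap
    set W := Ω δ b
    have ht0 : (0 : ℝ) < W / (8 * b ^ 2) := by positivity
    have hηt := hη.1 _ ht0
    have hrW : r = W / (8 * b) * η (W / (8 * b ^ 2)) := by
      rw [hr, hω, uniquenessModulus, one_div_mul_eq_div, one_div_mul_eq_div]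
      ring
    have hrW' : r ≤ W / (8 * b) := by
      rw [hrW]; exact mul_le_of_le_one_right (by positivity) hηt.2
    have hcmp : W / (2 * b) = 4 * (W / (8 * b)) := by field_simp; ring
    have hpos : 0 < W / (8 * b) := by positivity
    obtain ⟨h4, h5, h6⟩ := main W hW h1 (by linarith)
    have h7 := disp _ h5 h6
    rw [hrW] at h7
    -- Cancelling `η t` gives `R ≤ W / (8b)`, hence `s ≤ 2R ≤ W / (4b)`, against `W / (2b) < s`.
    have h8 := le_of_mul_le_mul_right h7 hηt.1
    linarith
  · set δ := b * η (ε / b) with hδ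
    have hη0 := (hη.1 _ hεb.1).1
    have hδ0 : 0 < δ := by positivity
    have hgap : δ ≤ a - ‖z‖ := by
      -- Using `ε / a` in place of `ε / b` gives the gap `a η(ε/a) = ε η'(ε/a)`, which is at least
      -- `ε η'(ε/b) = b η(ε/b)`.
      have h := hη.norm_midpoint_le hεa ha0 le_rfl hyx (by
        rw [div_mul_cancel₀ _ ha0.ne']; exact hlt.le)
      have h1 : δ = ε * η' (ε / b) := by rw [hδ, hfac _ hεb]; field_simp
      have h2 : a * η (ε / a) = ε * η' (ε / a) := by rw [hfac _ hεa]; field_simp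
      have h3 := mul_le_mul_of_nonneg_left (hmon hεb hεa hba) hε.le
      linarith
    have hW := hΩ.1 δ hδ0 b hb
    have h1 := gap δ hδ0 hgap
    set W := Ω δ b
    have hωε : ω ε = min (b * η (W / (8 * b ^ 2))) (W / (4 * b)) := by
      rw [hω, improvedUniquenessModulus]
    have hr1 : r ≤ 2 * (b * η (W / (8 * b ^ 2))) := by
      rw [hr, hωε]; linarith [min_le_left (b * η (W / (8 * b ^ 2))) (W / (4 * b))]
    have hr2 : r ≤ W / (2 * b) := by
      have : W / (2 * b) = 2 * (W / (4 * b)) := by field_simp; ring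
      rw [this, hr, hωε]
      linarith [min_le_right (b * η (W / (8 * b ^ 2))) (W / (4 * b))]
    obtain ⟨h4, h5, h6⟩ := main W hW h1 hr2
    have hs0 : 0 < s := lt_trans (by positivity) h4
    have hsR' : s / R ∈ Ioc (0 : ℝ) 2 := ⟨by positivity, by rwa [div_le_iff₀ hR0]⟩
    -- With the exact ratio `s / R`, monotonicity of `η'` yields `r ≥ s η'(s/R) > 4 b η(t)`, while
    -- `r ≤ 2 b η(t)`.
    have h7 := disp _ hsR' (by rw [div_mul_cancel₀ _ hR0.ne'])
    have hηt := (hη.1 _ h5.1).1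
    have h8 : R * η (s / R) = s * η' (s / R) := by rw [hfac _ hsR']; field_simp
    have h9 := hmon h5 hsR' (by rwa [le_div_iff₀ hR0])
    have h10 := hfac _ h5
    set t := W / (8 * b ^ 2) with ht
    have h11 : 0 < η' t := pos_of_mul_pos_right (h10 ▸ hηt) h5.1.le
    have h12 : s * η' t ≤ s * η' (s / R) := mul_le_mul_of_nonneg_left h9 hs0.le
    have h13 : W / (2 * b) * η' t < s * η' t := mul_lt_mul_of_pos_right h4 h11
    have h14 : W / (2 * b) * η' t = 4 * (b * η t) := by
      rw [h10, ht]; field_simp; ring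
    have : 0 < b * η t := by positivity
    linarith

/-- Approximate fixed points of a nonexpansive map `T` with `I - T` uniformly accretive are close
to each other. -/
theorem norm_sub_le_of_approx_fixed {C : Set X} (hC : Convex ℝ C) {b : ℝ} (hb : 0 < b)
    (hCb : ∀ x ∈ C, ‖x‖ ≤ b) {η : ℝ → ℝ} (hη : IsUniformConvexityModulus X η)
    {T : X → X} (hTC : MapsTo T C C) (hT : ∀ x ∈ C, ∀ y ∈ C, ‖T x - T y‖ ≤ ‖x - y‖)
    {Ω : ℝ → ℝ → ℝ} (hΩ : IsUniformAccretivityModulus (idSubGraph T C) Ω)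
    {ω : ℝ → ℝ} (hω : ω = uniquenessModulus η Ω b ∨
      (HasMonotoneFactor η ∧ ω = improvedUniquenessModulus η Ω b))
    {ε : ℝ} (hε : 0 < ε) {x y : X} (hx : x ∈ C) (hy : y ∈ C)
    (hrx : ‖x - T x‖ ≤ 2 * ω ε) (hry : ‖y - T y‖ ≤ 2 * ω ε) :
    ‖x - y‖ ≤ ε := by
  rcases le_total ‖y‖ ‖x‖ with h | h
  · exact norm_sub_le_of_approx_fixed_of_norm_le hC hb hCb hη hTC hT hΩ hω hε hx hy h hrx hry
  · rw [norm_sub_rev]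
    exact norm_sub_le_of_approx_fixed_of_norm_le hC hb hCb hη hTC hT hΩ hω hε hy hx h hry hrx

theorem uniquenessModulus_pos {A : Set (X × X)} {b : ℝ} (hb : 0 < b) {η : ℝ → ℝ}
    (hη : IsUniformConvexityModulus X η) {Ω : ℝ → ℝ → ℝ} (hΩ : IsUniformAccretivityModulus A Ω)
    {ε : ℝ} (hε : 0 < ε) : 0 < uniquenessModulus η Ω b ε := by
  have h1 := (hη.1 (ε / b) (by positivity)).1
  have h2 := hΩ.1 (ε / 2 * η (ε / b)) (by positivity) b hb
  have h3 := (hη.1 (1 / (8 * b ^ 2) * Ω (ε / 2 * η (ε / b)) b) (by positivity)).1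
  rw [uniquenessModulus]
  positivity

theorem improvedUniquenessModulus_pos {A : Set (X × X)} {b : ℝ} (hb : 0 < b) {η : ℝ → ℝ}
    (hη : IsUniformConvexityModulus X η) {Ω : ℝ → ℝ → ℝ} (hΩ : IsUniformAccretivityModulus A Ω)
    {ε : ℝ} (hε : 0 < ε) : 0 < improvedUniquenessModulus η Ω b ε := by
  have h1 := (hη.1 (ε / b) (by positivity)).1
  have h2 := hΩ.1 (b * η (ε / b)) (by positivity) b hb
  have h3 := (hη.1 (Ω (b * η (ε / b)) b / (8 * b ^ 2)) (by positivity)).1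
  exact lt_min (by positivity) (by positivity)

end UniformlyConvex

/-! ### Rate of asymptotic regularity. -/

section KrasnoselskiiMann

variable {X : Type*} [NormedAddCommGroup X] [NormedSpace ℝ X]

/-- The rate counts the term of index `γ k`, which `range n` may miss; that term is at most `1 / 4`.
-/
theorem IsDivergenceRate.le_sum_range {γ : ℕ → ℕ} {β : ℕ → ℝ} (hβ : ∀ n, β n ∈ Icc (0 : ℝ) 1)
    (hγ : IsDivergenceRate γ fun n => β n * (1 - β n)) {k n : ℕ} (hn : γ k ≤ n) :
    (k : ℝ) - 1 / 4 ≤ ∑ i ∈ Finset.range n, β i * (1 - β i) := by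
  have h := hγ k
  rw [Finset.sum_range_succ] at h
  have h1 : ∑ i ∈ Finset.range (γ k), β i * (1 - β i) ≤ ∑ i ∈ Finset.range n, β i * (1 - β i) :=
    Finset.sum_le_sum_of_subset_of_nonneg (Finset.range_mono hn)
      fun i _ _ => mul_nonneg (hβ i).1 (sub_nonneg.2 (hβ i).2)
  nlinarith [sq_nonneg (β (γ k) - 1 / 2)]

/-- Asymptotic regularity of Krasnoselskii-Mann iterations. -/
theorem krasnoselskiiMann_residual_le {C : Set X} (hC : Convex ℝ C) {D : ℝ}
    (hD : ∀ x ∈ C, ∀ y ∈ C, ‖x - y‖ ≤ D)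
    {T : X → X} (hTC : MapsTo T C C) (hT : ∀ x ∈ C, ∀ y ∈ C, ‖T x - T y‖ ≤ ‖x - y‖)
    {β : ℕ → ℝ} (hβ : ∀ n, β n ∈ Icc (0 : ℝ) 1) {x₀ : X} (hx₀ : x₀ ∈ C) {n : ℕ}
    (hσ : 0 < ∑ i ∈ Finset.range n, β i * (1 - β i)) :
    ‖krasnoselskiiMann T β x₀ n - T (krasnoselskiiMann T β x₀ n)‖ ≤
      D * (√Real.pi / (2 * √(∑ i ∈ Finset.range n, β i * (1 - β i)))) := by
  rw [norm_sub_rev]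
  refine ((krasnoselskiiMann_dist_le hC hD hTC hT hβ hx₀ n n le_rfl).2).trans ?_
  exact mul_le_mul_of_nonneg_left (walkBound_self_one_le hβ n hσ)
    ((norm_nonneg _).trans (hD x₀ hx₀ x₀ hx₀))

theorem krasnoselskiiMann_residual_le_of_rate {C : Set X} (hC : Convex ℝ C) {b : ℝ} (hb : 0 < b)
    (hCb : ∀ x ∈ C, ‖x‖ ≤ b)
    {T : X → X} (hTC : MapsTo T C C) (hT : ∀ x ∈ C, ∀ y ∈ C, ‖T x - T y‖ ≤ ‖x - y‖)
    {β : ℕ → ℝ} (hβ : ∀ n, β n ∈ Icc (0 : ℝ) 1)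
    {γ : ℕ → ℕ} (hγ : IsDivergenceRate γ fun n => β n * (1 - β n))
    {x₀ : X} (hx₀ : x₀ ∈ C) {w : ℝ} (hw : 0 < w) {n : ℕ}
    (hn : γ ⌈4 * b ^ 2 / (Real.pi * w ^ 2)⌉₊ ≤ n) :
    ‖krasnoselskiiMann T β x₀ n - T (krasnoselskiiMann T β x₀ n)‖ ≤ 2 * w := by
  have hπ := Real.pi_pos
  set k := ⌈4 * b ^ 2 / (Real.pi * w ^ 2)⌉₊ with hk
  have hq : 0 < 4 * b ^ 2 / (Real.pi * w ^ 2) := by positivity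
  have hk0 : (1 : ℝ) ≤ k := by exact_mod_cast Nat.ceil_pos.2 hq
  have hkq : 4 * b ^ 2 / (Real.pi * w ^ 2) ≤ k := Nat.le_ceil _
  have hσ := hγ.le_sum_range hβ hn
  set σ := ∑ i ∈ Finset.range n, β i * (1 - β i) with hσdef
  have hσk : 3 / 4 * (k : ℝ) ≤ σ := by linarith
  have hσ0 : 0 < σ := by linarith
  refine (krasnoselskiiMann_residual_le hC (D := 2 * b)
    (fun x hx y hy => (norm_sub_le x y).trans (by linarith [hCb x hx, hCb y hy]))
    hTC hT hβ hx₀ hσ0).trans ?_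
  rw [← hσdef]
  have hsq : 3 * b ^ 2 ≤ Real.pi * w ^ 2 * σ := by
    rw [div_le_iff₀ (by positivity)] at hkq
    have : Real.pi * w ^ 2 * (3 / 4 * k) ≤ Real.pi * w ^ 2 * σ :=
      mul_le_mul_of_nonneg_left hσk (by positivity)
    linarith
  -- After squaring, `3 b² ≤ π w² σ` suffices because `π² ≤ 12`; the target `2 * w` leaves room for
  -- the non-sharp Gaussian constant and the lost `1 / 4`.
  have hfin : b * √Real.pi ≤ 2 * w * √σ := by
    refine abs_le_of_sq_le_sq' ?_ (by positivity) |>.2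
    rw [mul_pow, mul_pow, Real.sq_sqrt hπ.le, Real.sq_sqrt hσ0.le]
    have h4 : Real.pi ≤ 3.15 := Real.pi_lt_d2.le
    have h5 : Real.pi * Real.pi ≤ 12 := by nlinarith
    have h6 : 0 < Real.pi * (w ^ 2 * σ) := by positivity
    have h7 : Real.pi * (3 * (b ^ 2 * Real.pi)) ≤ Real.pi * (12 * (w ^ 2 * σ)) := by
      nlinarith [mul_le_mul_of_nonneg_right h5 (sq_nonneg b)]
    have := le_of_mul_le_mul_left h7 hπ
    linarith
  rw [mul_div_assoc', div_le_iff₀ (by positivity)]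
  linarith

end KrasnoselskiiMann

/-! ### Cauchy rate, fixed point and convergence. -/

theorem mainTheorem5 {X : Type*} [NormedAddCommGroup X] [NormedSpace ℝ X]
    (C : Set X) (hC : Convex ℝ C)
    (b : ℝ) (hb : 0 < b) (hCb : ∀ x ∈ C, ‖x‖ ≤ b)
    (η : ℝ → ℝ) (hη : IsUniformConvexityModulus X η)
    (T : X → X) (hTC : MapsTo T C C) (hT : ∀ x ∈ C, ∀ y ∈ C, ‖T x - T y‖ ≤ ‖x - y‖)
    (Ω : ℝ → ℝ → ℝ) (hΩ : IsUniformAccretivityModulus (idSubGraph T C) Ω)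
    (β : ℕ → ℝ) (hβ : ∀ n, β n ∈ Icc (0 : ℝ) 1)
    (γ : ℕ → ℕ) (hγ : IsDivergenceRate γ (fun n => β n * (1 - β n)))
    (x₀ : X) (hx₀ : x₀ ∈ C)
    (ω : ℝ → ℝ)
    (hω : ω = uniquenessModulus η Ω b ∨
      (HasMonotoneFactor η ∧ ω = improvedUniquenessModulus η Ω b)) :
    CauchySeq (krasnoselskiiMann T β x₀) ∧
    IsCauchyRate (kmRate γ b ω) (krasnoselskiiMann T β x₀) ∧
    (CompleteSpace X → IsClosed C →
      ∃ p ∈ C, T p = p ∧ (∀ q ∈ C, T q = q → q = p) ∧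
        Tendsto (krasnoselskiiMann T β x₀) atTop (𝓝 p) ∧
        IsConvergenceRate (kmRate γ b ω) (krasnoselskiiMann T β x₀) p) := by

  set x := krasnoselskiiMann T β x₀
  have hmem : ∀ n, x n ∈ C := krasnoselskiiMann_mem hC hTC hβ hx₀
  have hωpos : ∀ ε > 0, 0 < ω ε := by
    intro ε hε
    rcases hω with h | ⟨-, h⟩
    · rw [h]; exact uniquenessModulus_pos hb hη hΩ hε
    · rw [h]; exact improvedUniquenessModulus_pos hb hη hΩ hε
  have hres : ∀ w > 0, ∀ n ≥ γ ⌈4 * b ^ 2 / (Real.pi * w ^ 2)⌉₊, ‖x n - T (x n)‖ ≤ 2 * w :=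
    fun w hw n hn =>
      krasnoselskiiMann_residual_le_of_rate hC hb hCb hTC hT hβ hγ hx₀ hw hn
  have hclose : ∀ ε > 0, ∀ y ∈ C, ∀ z ∈ C, ‖y - T y‖ ≤ 2 * ω ε → ‖z - T z‖ ≤ 2 * ω ε →
      ‖y - z‖ ≤ ε := fun ε hε y hy z hz =>
    norm_sub_le_of_approx_fixed hC hb hCb hη hTC hT hΩ hω hε hy hz
  have hrate : IsCauchyRate (kmRate γ b ω) x := fun ε hε n hn m hm =>
    hclose ε hε _ (hmem n) _ (hmem m) (hres _ (hωpos ε hε) n hn) (hres _ (hωpos ε hε) m hm)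
  have hcauchy : CauchySeq x := by
    refine Metric.cauchySeq_iff.2 fun ε hε => ⟨kmRate γ b ω (ε / 2), fun m hm n hn => ?_⟩
    rw [dist_eq_norm]
    exact (hrate (ε / 2) (half_pos hε) m hm n hn).trans_lt (half_lt_self hε)
  refine ⟨hcauchy, hrate, fun _ hclosed => ?_⟩
  obtain ⟨p, hp⟩ := cauchySeq_tendsto_of_complete hcauchy
  have hpC : p ∈ C := hclosed.mem_of_tendsto hp (Eventually.of_forall hmem)
  have hresid : Tendsto (fun n => x n - T (x n)) atTop (𝓝 0) := by
    refine Metric.tendsto_atTop.2 fun ε hε =>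
      ⟨γ ⌈4 * b ^ 2 / (Real.pi * (ε / 4) ^ 2)⌉₊, fun n hn => ?_⟩
    rw [dist_zero_right]
    exact (hres (ε / 4) (by positivity) n hn).trans_lt (by linarith)
  have hTlim : Tendsto (fun n => T (x n)) atTop (𝓝 (T p)) := by
    rw [tendsto_iff_norm_sub_tendsto_zero] at hp ⊢
    exact squeeze_zero (fun _ => norm_nonneg _) (fun n => hT _ (hmem n) _ hpC) hp
  have hfix : T p = p :=
    (sub_eq_zero.1 (tendsto_nhds_unique (hp.sub hTlim) hresid)).symm
  have hzero : ∀ q, T q = q → ∀ ε > 0, ‖q - T q‖ ≤ 2 * ω ε := fun q hq ε hε => by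
    rw [hq, sub_self, norm_zero]
    linarith [hωpos ε hε]
  -- A fixed point has residual `0`, so comparing it directly with `x n` keeps the same rate.
  refine ⟨p, hpC, hfix, fun q hq hTq => ?_, hp, fun ε hε n hn =>
    hclose ε hε _ (hmem n) _ hpC (hres _ (hωpos ε hε) n hn) (hzero p hfix ε hε)⟩
  refine sub_eq_zero.1 (norm_le_zero_iff.1 (le_of_forall_gt_imp_ge_of_dense fun ε hε => ?_))
  exact hclose ε hε _ hq _ hpC (hzero q hTq ε hε) (hzero p hfix ε hε)
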